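/- **Theorem (Tweedie's formula in infinite-dimensional Banach spaces).** Let $B$ be a separable real Banach space with its Borel $\sigma$-algebra and let $\gamma$ be a centered Gaussian measure on $B$. Let $B^*_\gamma$ be the closure of $B^*$ in $L^2(\gamma)$, put $C_\gamma f=\int_B f(x)\,x\,d\gamma(x)\in B$ for $f\in B^*_\gamma$, and let $H(\gamma)=C_\gamma(B^*_\gamma)\subset B$ be the Cameron–Martin space, a Hilbert space with $\langle C_\gamma f,C_\gamma g\rangle_{H(\gamma)}=\int fg\,d\gamma$; let $R:H(\gamma)^*\to H(\gamma)$ be its Riesz isometry. A function $f:B\to\mathbb R$ is called Fréchet differentiable along $H(\gamma)$ at $y$, with derivative $D_{H(\gamma)}f(y)\in H(\gamma)^*$, if $h\mapsto f(y+h)$, $H(\gamma)\to\mathbb R$, is Fréchet differentiable at $0$ with this derivative. Let $X\sim\mu$ and $Z\sim\gamma$ be independent $B$-valued random variables, $Y=X+Z$, and let $\nu=\mu\star\gamma$ be the law of $Y$. Write $\gamma^x$ for the law of $Z+x$. Assume: 1. $\mu(H(\gamma))=1$; 2. $\varphi:B\to\mathbb R$ is a version of $\log\frac{d\nu}{d\gamma}$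 (that is, equal to it $\gamma$-almost everywhere) which is Fréchet differentiable along $H(\gamma)$ at $\gamma$-almost every point; 3. there are versions $p(x,\cdot)$ of $\frac{d\gamma^x}{d\gamma}$ (for $\mu$-almost every $x$), jointly measurable in $(x,y)$, such that for $\gamma$-almost every $y$ there is $\psi_y\in L^1(\mu)$ such that for $\mu$-almost every $x$ the function $p(x,\cdot)$ is Fréchet differentiable along $H(\gamma)$ at $y$ and $\|D_{H(\gamma)}\,p(x,\cdot)(y)\|_{H(\gamma)^*}\le\psi_y(x)$. Then for $\nu$-almost every $y$ the regular conditional distribution of $X$ given $Y=y$ has a (Bochner) mean $\mathbb E[X\mid Y=y]$, and $$\mathbb E[X\mid Y=y]=R\bigl(D_{H(\gamma)}\varphi(y)\bigr)=R\Bigl(D_{H(\gamma)}\log\tfrac{d\nu}{d\gamma}(y)\Bigr).$$ In particular, if $\mathbb E\|X\|<\infty$, then $\mathbb E[X\mid\sigma(Y)]=R\bigl(D_{H(\gamma)}\varphi(Y)\bigr)$ almost surely. -/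

import Mathlib

open MeasureTheory ProbabilityTheory
open scoped ENNReal

noncomputable section

namespace Tweedie

section CameronMartin

variable {B : Type*} [NormedAddCommGroup B] [NormedSpace ℝ B] [CompleteSpace B]
  [SecondCountableTopology B] [MeasurableSpace B] [BorelSpace B]

/-- The reproducing kernel Hilbert space `B*_γ` of a centered Gaussian measure `γ`: the closure
of the dual space `B*` in `L²(γ)`, with the inner product of `L²(γ)`. -/
def rkhs (γ : Measure B) : Submodule ℝ (Lp ℝ 2 γ) :=
  (LinearMap.range (StrongDual.toLpₗ (𝕜 := ℝ) γ 2)).topologicalClosure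

lemma integrable_smul_id (γ : Measure B) [IsGaussian γ] (f : Lp ℝ 2 γ) :
    Integrable (fun x => f x • x) γ :=
  memLp_one_iff_integrable.mp
    (MemLp.smul (p := 2) (q := 2) (IsGaussian.memLp_id γ 2 (by norm_num)) (Lp.memLp f))

/-- The covariance operator `C_γ f = ∫ f(x) x dγ(x)`. As a Bochner integral it is the element
of `B` with `g (C_γ f) = ∫ f g dγ` for all `g ∈ B*`. -/
def covOp (γ : Measure B) [IsGaussian γ] : Lp ℝ 2 γ →ₗ[ℝ] B where
  toFun f := ∫ x, f x • x ∂γ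
  map_add' f g := by
    rw [← integral_add (integrable_smul_id γ f) (integrable_smul_id γ g)]
    refine integral_congr_ae ?_
    filter_upwards [Lp.coeFn_add f g] with x hx
    rw [hx, Pi.add_apply, add_smul]
  map_smul' c f := by
    rw [RingHom.id_apply, ← integral_smul]
    refine integral_congr_ae ?_
    filter_upwards [Lp.coeFn_smul c f] with x hx
    rw [hx, Pi.smul_apply, smul_eq_mul, mul_smul]

lemma apply_covOp (γ : Measure B) [IsGaussian γ] (f : Lp ℝ 2 γ) (g : StrongDual ℝ B) :
    g (covOp γ f) = ∫ x, f x * g x ∂γ := by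
  change g (∫ x, f x • x ∂γ) = _
  rw [← g.integral_comp_comm (integrable_smul_id γ f)]
  simp

lemma covOp_injOn (γ : Measure B) [IsGaussian γ] {f : Lp ℝ 2 γ} (hf : f ∈ rkhs γ)
    (h0 : covOp γ f = 0) : f = 0 := by
  have hm : MemLp id 2 γ := IsGaussian.memLp_id γ 2 (by norm_num)
  have h1 : (LinearMap.range (StrongDual.toLpₗ (𝕜 := ℝ) γ 2)) ≤ (ℝ ∙ f)ᗮ := by
    rintro _ ⟨g, rfl⟩
    rw [Submodule.mem_orthogonal_singleton_iff_inner_right, L2.inner_def]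
    have h2 := apply_covOp γ f g
    rw [h0, map_zero] at h2
    rw [h2]
    refine integral_congr_ae ?_
    rw [StrongDual.toLpₗ_apply hm]
    filter_upwards [MemLp.coeFn_toLp (f := ⇑g) (hm.continuousLinearMap_comp g)] with x hx
    rw [hx]
    simp [mul_comm]
  have h3 := Submodule.topologicalClosure_minimal _ h1 (Submodule.isClosed_orthogonal _) hf
  rw [Submodule.mem_orthogonal_singleton_iff_inner_right] at h3
  exact inner_self_eq_zero.mp h3

/-- The Cameron–Martin space `H(γ) = C_γ(B*_γ)`, as a linear subspace of `B`. -/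
def cameronMartin (γ : Measure B) [IsGaussian γ] : Submodule ℝ B :=
  (rkhs γ).map (covOp γ)

/-- The Cameron–Martin space as a type of its own, so that it can carry the Hilbert norm
`|C_γ f|_{H(γ)} = ‖f‖_{L²(γ)}` instead of the norm of `B`. -/
def CM (γ : Measure B) [IsGaussian γ] : Type _ := cameronMartin γ

instance (γ : Measure B) [IsGaussian γ] : AddCommGroup (CM γ) :=
  inferInstanceAs (AddCommGroup (cameronMartin γ))

instance (γ : Measure B) [IsGaussian γ] : Module ℝ (CM γ) :=
  inferInstanceAs (Module ℝ (cameronMartin γ))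

/-- The inclusion `H(γ) → B`. -/
def CM.incl (γ : Measure B) [IsGaussian γ] : CM γ →ₗ[ℝ] B := (cameronMartin γ).subtype

/-- The bijection `C_γ : B*_γ → H(γ)`. -/
def CM.covEquiv (γ : Measure B) [IsGaussian γ] : rkhs γ ≃ₗ[ℝ] CM γ :=
  LinearEquiv.ofBijective
    (((covOp γ).restrict (p := rkhs γ) (q := cameronMartin γ)
      (fun _ hx => Submodule.mem_map_of_mem hx)) : rkhs γ →ₗ[ℝ] cameronMartin γ)
    ⟨(injective_iff_map_eq_zero _).mpr (fun f hf =>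
        Subtype.ext (covOp_injOn γ f.2 (congrArg Subtype.val hf))),
      by
        rintro ⟨_, f, hf, rfl⟩
        exact ⟨⟨f, hf⟩, rfl⟩⟩

lemma CM.incl_covEquiv (γ : Measure B) [IsGaussian γ] (f : rkhs γ) :
    CM.incl γ (CM.covEquiv γ f) = covOp γ f := rfl

instance (γ : Measure B) [IsGaussian γ] : NormedAddCommGroup (CM γ) :=
  NormedAddCommGroup.induced (CM γ) (rkhs γ) (CM.covEquiv γ).symm (CM.covEquiv γ).symm.injective

/-- The inner product `⟨C_γ f, C_γ g⟩_{H(γ)} = ∫ f g dγ`. -/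
instance (γ : Measure B) [IsGaussian γ] : InnerProductSpace ℝ (CM γ) :=
  { (NormedSpace.induced ℝ (CM γ) (rkhs γ) (CM.covEquiv γ).symm : NormedSpace ℝ (CM γ)) with
    inner := fun h k => inner ℝ ((CM.covEquiv γ).symm h) ((CM.covEquiv γ).symm k)
    norm_sq_eq_re_inner := fun h => norm_sq_eq_re_inner (𝕜 := ℝ) ((CM.covEquiv γ).symm h)
    conj_inner_symm := fun _ _ => inner_conj_symm _ _
    add_left := fun h k l => by
      simp only [map_add, inner_add_left]
    smul_left := fun h k c => by
      rw [map_smul]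
      exact inner_smul_left (𝕜 := ℝ) ((CM.covEquiv γ).symm h) ((CM.covEquiv γ).symm k) c }

lemma CM.inner_covEquiv (γ : Measure B) [IsGaussian γ] (f g : rkhs γ) :
    inner ℝ (CM.covEquiv γ f) (CM.covEquiv γ g) = inner ℝ f g := by
  change inner ℝ ((CM.covEquiv γ).symm _) ((CM.covEquiv γ).symm _) = _
  simp

/-- `C_γ : B*_γ → H(γ)` as an isometric isomorphism. -/
def CM.covIsometry (γ : Measure B) [IsGaussian γ] : rkhs γ ≃ₗᵢ[ℝ] CM γ :=
  (CM.covEquiv γ).isometryOfInner (CM.inner_covEquiv γ)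

instance (γ : Measure B) : CompleteSpace (rkhs γ) :=
  (Submodule.isClosed_topologicalClosure _).completeSpace_coe

instance (γ : Measure B) [IsGaussian γ] : CompleteSpace (CM γ) :=
  (completeSpace_congr (e := (CM.covIsometry γ).toEquiv)
    (CM.covIsometry γ).isometry.isUniformEmbedding).mp inferInstance

/-- The Riesz isometry `R : H(γ)* → H(γ)`. -/
def riesz (γ : Measure B) [IsGaussian γ] (L : StrongDual ℝ (CM γ)) : CM γ :=
  (InnerProductSpace.toDual ℝ (CM γ)).symm L

/-- `f : B → ℝ` is Fréchet differentiable along `H(γ)` at `y`: the map `h ↦ f (y + h)` on the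
Hilbert space `H(γ)` is Fréchet differentiable at `0`. -/
def DifferentiableAlongAt (γ : Measure B) [IsGaussian γ] (f : B → ℝ) (y : B) : Prop :=
  DifferentiableAt ℝ (fun h : CM γ => f (y + CM.incl γ h)) 0

/-- The Fréchet derivative `D_{H(γ)} f (y) ∈ H(γ)*` of `f` along `H(γ)` at `y`. -/
def derivAlong (γ : Measure B) [IsGaussian γ] (f : B → ℝ) (y : B) : StrongDual ℝ (CM γ) :=
  fderiv ℝ (fun h : CM γ => f (y + CM.incl γ h)) 0

end CameronMartin

end Tweedie

end

/-
Let `q = dν/dγ` and let `κ_y` be the law of `X` given `Y = y`. Translating `Z` by `C_γ g`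
(`g ∈ B*`) multiplies its law by a constant times `exp g`; since `g X = g Y - g Z`, Bayes' rule
turns this into `q (y + C_γ g) = q y * ∫ exp (g x) κ_y(dx)`. So along `y + t C_γ g` the log-density
is, up to a constant, the cumulant generating function of `g` under `κ_y`, whose derivative at
`t = 0` is the posterior mean of `g`, and this is also the pairing of `D_H φ(y)` with `C_γ g`. The
mean of `κ_y` exists because `X = Y - Z` with `Z` integrable (Fernique). That `ν ≪ γ` is the
Cameron–Martin theorem: translation by `C_γ g` satisfies `γ(U - C_γ g) ≤ exp (|C_γ g|² / 2) γ(U)^½`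
by Cauchy–Schwarz, a bound which for open `U` passes to the limit in `C_γ g`.
-/

namespace Tweedie

section AbsoluteContinuity

open Filter Topology

lemma lowerSemicontinuous_measure_preimage_add_const {G : Type*} [TopologicalSpace G] [Add G]
    [ContinuousAdd G] [MeasurableSpace G] [OpensMeasurableSpace G] (m : Measure G)
    [m.InnerRegular] {U : Set G} (hU : IsOpen U) :
    LowerSemicontinuous fun x => m ((· + x) ⁻¹' U) := by
  intro x c hc
  obtain ⟨K, hKU, hK, hcK⟩ :=
    (hU.preimage (continuous_add_const x)).measurableSet.exists_lt_isCompact hc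
  have hnear : ∀ᶠ x' in 𝓝 x, ∀ y ∈ K, y + x' ∈ U :=
    hK.eventually_forall_of_forall_eventually fun y hy =>
      (continuous_snd.add continuous_fst).continuousAt.eventually (hU.mem_nhds (hKU hy))
  filter_upwards [hnear] with x' hx'
  exact hcK.trans_le (measure_mono hx')

lemma absolutelyContinuous_of_forall_isOpen_le {α : Type*} [TopologicalSpace α] [MeasurableSpace α]
    {ρ m : Measure α} [m.OuterRegular] {θ : ℝ≥0∞ → ℝ≥0∞} (hθ : Tendsto θ (𝓝 0) (𝓝 0))
    (h : ∀ U, IsOpen U → ρ U ≤ θ (m U)) : ρ ≪ m := by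
  intro s hs
  refine le_antisymm (le_of_forall_gt fun ε hε => ?_) zero_le
  obtain ⟨δ, hδ, hθδ⟩ := (ENNReal.nhds_zero_basis.tendsto_left_iff.mp hθ) _ (Iio_mem_nhds hε)
  obtain ⟨U, hsU, hU, hUδ⟩ := s.exists_isOpen_lt_of_lt (μ := m) δ (hs.trans_lt hδ)
  exact (measure_mono hsU).trans_lt ((h U hU).trans_lt (hθδ hUδ))

lemma conv_absolutelyContinuous_of_ae_map_add {G : Type*} [AddCommMonoid G] [MeasurableSpace G]
    [MeasurableAdd₂ G] {μ γ : Measure G} [SFinite μ] [SFinite γ]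
    (h : ∀ᵐ x ∂μ, γ.map (· + x) ≪ γ) : μ.conv γ ≪ γ := by
  refine Measure.AbsolutelyContinuous.mk fun s hs hs0 => ?_
  rw [← lintegral_indicator_one hs, Measure.lintegral_conv (measurable_one.indicator hs)]
  refine lintegral_eq_zero_of_ae_eq_zero ?_
  filter_upwards [h] with x hx
  have := hx hs0
  rw [Measure.map_apply (by fun_prop) hs] at this
  simp_rw [add_comm x]
  change ∫⁻ y, ((· + x) ⁻¹' s).indicator 1 y ∂γ = 0
  rw [lintegral_indicator_one (measurable_add_const x hs), this]

end AbsoluteContinuity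

section Gaussian

variable {E : Type*} [NormedAddCommGroup E] [NormedSpace ℝ E] [MeasurableSpace E]
  (γ : Measure E) [IsGaussian γ]

lemma integral_exp_dual (g : StrongDual ℝ E) :
    ∫ y, Real.exp (g y) ∂γ = Real.exp (γ[g] + Var[g; γ] / 2) := by
  have h := mgf_gaussianReal (IsGaussian.map_eq_gaussianReal (μ := γ) g) 1
  simpa [mgf, Real.coe_toNNReal _ (variance_nonneg _ _)] using h

lemma integrable_exp_dual (g : StrongDual ℝ E) : Integrable (fun y => Real.exp (g y)) γ :=
  .of_integral_ne_zero (by rw [integral_exp_dual]; exact Real.exp_ne_zero _)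

lemma lintegral_exp_dual_rpow (g : StrongDual ℝ E) (p : ℝ) :
    ∫⁻ y, ENNReal.ofReal (Real.exp (g y)) ^ p ∂γ =
      ENNReal.ofReal (Real.exp (p * γ[g] + p ^ 2 * Var[g; γ] / 2)) := by
  have hpg : ⇑(p • g) = fun y => p * g y := rfl
  have hrpow (y : E) : ENNReal.ofReal (Real.exp (g y)) ^ p =
      ENNReal.ofReal (Real.exp ((p • g) y)) := by
    rw [ENNReal.ofReal_rpow_of_pos (Real.exp_pos _), ← Real.exp_mul, mul_comm, hpg]
  rw [lintegral_congr hrpow, ← ofReal_integral_eq_lintegral_ofReal (integrable_exp_dual γ _)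
    (ae_of_all _ fun _ => Real.exp_nonneg _), integral_exp_dual, hpg, variance_const_mul,
    integral_const_mul]

open Complex

lemma integral_cexp_mul_dual (L : StrongDual ℝ E) (z : ℂ) :
    ∫ y, cexp (z * L y) ∂γ = cexp (z * (γ[L] : ℝ) + Var[L; γ] * z ^ 2 / 2) := by
  have h := complexMGF_gaussianReal (IsGaussian.map_eq_gaussianReal (μ := γ) L) z
  rwa [Real.coe_toNNReal _ (variance_nonneg _ _)] at h

lemma exists_mul_variance_eq_covariance {Ω : Type*} [MeasurableSpace Ω] {P : Measure Ω}
    [IsProbabilityMeasure P] {U : Ω → ℝ} (hU : MemLp U 2 P) (V : Ω → ℝ) :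
    ∃ a : ℝ, a * Var[U; P] = cov[U, V; P] := by
  by_cases h0 : Var[U; P] = 0
  · refine ⟨0, ?_⟩
    rw [zero_mul, covariance]
    refine (integral_eq_zero_of_ae ?_).symm
    filter_upwards [ae_eq_integral_of_variance_eq_zero hU h0] with ω hω
    rw [hω, sub_self, zero_mul, Pi.zero_apply]
  · exact ⟨_, div_mul_cancel₀ _ h0⟩

lemma integral_cexp_mul_dual_add_mul_dual [BorelSpace E] {g K : StrongDual ℝ E}
    (hcov : cov[g, K; γ] = 0) (z w : ℂ) :
    ∫ y, cexp (z * g y + w * K y) ∂γ = (∫ y, cexp (z * g y) ∂γ) * ∫ y, cexp (w * K y) ∂γ := by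
  have hind : IndepFun g K γ :=
    (IsGaussian.hasGaussianLaw_id.map_fun (g.prod K)).indepFun_of_covariance_eq_zero hcov
  simp only [Complex.exp_add]
  exact (hind.comp (φ := fun s : ℝ => cexp (z * s)) (ψ := fun s : ℝ => cexp (w * s))
    (by fun_prop) (by fun_prop)).integral_fun_mul_eq_mul_integral (by fun_prop) (by fun_prop)

lemma integral_cexp_dual_add_dual_mul_I [BorelSpace E] (g L : StrongDual ℝ E) :
    ∫ y, cexp (g y + L y * I) ∂γ =
      cexp ((γ[g] : ℝ) + (γ[L] : ℝ) * I + (Var[g; γ] - Var[L; γ]) / 2 + cov[g, L; γ] * I) := by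
  have hmem (K : StrongDual ℝ E) : MemLp K 2 γ := IsGaussian.memLp_dual γ K 2 (by norm_num)
  obtain ⟨a, ha⟩ := exists_mul_variance_eq_covariance (hmem g) L
  -- `K` is the component of `L` uncorrelated with, hence independent of, `g`.
  obtain ⟨K, rfl⟩ : ∃ K, L = K + a • g := ⟨L - a • g, by simp⟩
  have hadd : ⇑(K + a • g) = ⇑K + fun y => a * g y := rfl
  have hag := (hmem g).const_mul a
  have hcov : cov[g, K; γ] = 0 := by
    rw [hadd, covariance_add_right (hmem g) (hmem K) hag, covariance_const_mul_right,
      covariance_self (hmem g).aemeasurable] at ha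
    linarith
  have hmean : γ[K + a • g] = γ[K] + a * γ[g] := by
    rw [← integral_const_mul, ← integral_add ((hmem K).integrable one_le_two)
      (hag.integrable one_le_two)]
    rfl
  have hvar : Var[K + a • g; γ] = Var[K; γ] + a ^ 2 * Var[g; γ] := by
    rw [hadd, variance_add (hmem K) hag, covariance_const_mul_right, covariance_comm, hcov,
      variance_const_mul]
    ring
  calc ∫ y, cexp (g y + (K + a • g) y * I) ∂γ
      = ∫ y, cexp ((1 + a * I) * g y + I * K y) ∂γ := by
        congr with y
        simp only [hadd, Pi.add_apply]
        push_cast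
        ring_nf
    _ = _ := by
        rw [integral_cexp_mul_dual_add_mul_dual γ hcov, integral_cexp_mul_dual,
          integral_cexp_mul_dual, ← Complex.exp_add, hmean, hvar, ← ha]
        congr 1
        push_cast
        linear_combination (a ^ 2 * Var[g; γ] / 2 + Var[K; γ] / 2 : ℂ) * I_sq

end Gaussian

section CameronMartin

variable {B : Type*} [NormedAddCommGroup B] [NormedSpace ℝ B] [CompleteSpace B]
  [SecondCountableTopology B] [MeasurableSpace B] [BorelSpace B] (γ : Measure B) [IsGaussian γ]

lemma coeFn_toLp (g : StrongDual ℝ B) : ⇑(StrongDual.toLpₗ (𝕜 := ℝ) γ 2 g) =ᵐ[γ] g := by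
  have hm : MemLp id 2 γ := IsGaussian.memLp_id γ 2 (by norm_num)
  rw [StrongDual.toLpₗ_apply hm]
  exact MemLp.coeFn_toLp (f := ⇑g) (hm.continuousLinearMap_comp g)

/-- The covariance operator `g ↦ C_γ g` on `B*`, with values in `H(γ)`. -/
noncomputable def CM.ofDual : StrongDual ℝ B →ₗ[ℝ] CM γ :=
  (CM.covEquiv γ).toLinearMap ∘ₗ (StrongDual.toLpₗ (𝕜 := ℝ) γ 2).codRestrict (rkhs γ)
    (fun g => Submodule.le_topologicalClosure _ ⟨g, rfl⟩)

lemma CM.inner_ofDual (h : CM γ) (g : StrongDual ℝ B) :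
    inner ℝ h (CM.ofDual γ g) = g (CM.incl γ h) := by
  obtain ⟨f, rfl⟩ := (CM.covEquiv γ).surjective h
  rw [CM.incl_covEquiv, apply_covOp]
  change inner ℝ (CM.covEquiv γ f) (CM.covEquiv γ ⟨StrongDual.toLpₗ (𝕜 := ℝ) γ 2 g, _⟩) = _
  rw [CM.inner_covEquiv, Submodule.coe_inner, L2.inner_def]
  refine integral_congr_ae ?_
  filter_upwards [coeFn_toLp γ g] with y hy
  rw [hy, RCLike.inner_apply', conj_trivial]

lemma CM.apply_incl_ofDual (g L : StrongDual ℝ B) :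
    L (CM.incl γ (CM.ofDual γ g)) = ∫ y, g y * L y ∂γ := by
  change L (covOp γ (StrongDual.toLpₗ (𝕜 := ℝ) γ 2 g)) = _
  rw [apply_covOp]
  refine integral_congr_ae ?_
  filter_upwards [coeFn_toLp γ g] with x hx
  rw [hx]

lemma CM.denseRange_ofDual : DenseRange (CM.ofDual γ) := by
  refine Submodule.dense_iff_topologicalClosure_eq_top (s := LinearMap.range (CM.ofDual γ)).mpr
    (Submodule.topologicalClosure_eq_top_iff.mpr ((Submodule.eq_bot_iff _).mpr fun h hh => ?_))
  have hincl : CM.incl γ h = 0 :=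
    SeparatingDual.eq_zero_of_forall_dual_eq_zero (R := ℝ) fun g => by
      rw [← CM.inner_ofDual]
      exact (Submodule.mem_orthogonal' _ _).mp hh _ ⟨g, rfl⟩
  exact Subtype.ext hincl

lemma CM.norm_ofDual_le (g : StrongDual ℝ B) : ‖CM.ofDual γ g‖ ≤ ‖g‖ * (eLpNorm id 2 γ).toReal := by
  refine Eq.trans_le ?_ (StrongDual.norm_toLpₗ_le g)
  exact (CM.covIsometry γ).norm_map ⟨StrongDual.toLpₗ (𝕜 := ℝ) γ 2 g, _⟩

lemma CM.norm_incl_le (h : CM γ) : ‖CM.incl γ h‖ ≤ (eLpNorm id 2 γ).toReal * ‖h‖ := by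
  obtain ⟨L, hL, hLx⟩ := exists_dual_vector'' ℝ (CM.incl γ h)
  calc ‖CM.incl γ h‖ = inner ℝ h (CM.ofDual γ L) := by
        rw [CM.inner_ofDual, hLx, RCLike.ofReal_real_eq_id, id]
    _ ≤ ‖h‖ * ‖CM.ofDual γ L‖ := real_inner_le_norm _ _
    _ ≤ ‖h‖ * (‖L‖ * (eLpNorm id 2 γ).toReal) := by gcongr; exact CM.norm_ofDual_le γ L
    _ ≤ ‖h‖ * (1 * (eLpNorm id 2 γ).toReal) := by gcongr
    _ = _ := by ring

lemma CM.continuous_incl : Continuous (CM.incl γ) :=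
  AddMonoidHomClass.continuous_of_bound _ _ (CM.norm_incl_le γ)

variable {γ} (hγ : ∀ L : StrongDual ℝ B, ∫ z, L z ∂γ = 0)

include hγ

lemma CM.apply_incl_ofDual_eq_covariance (g L : StrongDual ℝ B) :
    L (CM.incl γ (CM.ofDual γ g)) = cov[g, L; γ] := by
  simp only [CM.apply_incl_ofDual, covariance, hγ, sub_zero]

lemma CM.norm_sq_ofDual (g : StrongDual ℝ B) : ‖CM.ofDual γ g‖ ^ 2 = Var[g; γ] := by
  rw [← real_inner_self_eq_norm_sq, CM.inner_ofDual, CM.apply_incl_ofDual_eq_covariance hγ,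
    covariance_self g.measurable.aemeasurable]

open Complex in
lemma map_add_ofDual_eq_tilted (g : StrongDual ℝ B) :
    γ.map (· + CM.incl γ (CM.ofDual γ g)) = γ.tilted g := by
  have := isProbabilityMeasure_tilted (integrable_exp_dual γ g)
  refine Measure.ext_of_charFunDual (funext fun L => ?_)
  calc charFunDual (γ.map (· + CM.incl γ (CM.ofDual γ g))) L
      = cexp (-Var[L; γ] / 2 + cov[g, L; γ] * I) := by
        rw [charFunDual_map_add_const, IsGaussian.charFunDual_eq_of_forall_strongDual_eq_zero hγ,
          CM.apply_incl_ofDual_eq_covariance hγ, ← Complex.exp_add]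
    _ = (cexp (Var[g; γ] / 2))⁻¹ * ∫ y, cexp (g y + L y * I) ∂γ := by
        rw [integral_cexp_dual_add_dual_mul_I, hγ, hγ, ← Complex.exp_neg, ← Complex.exp_add]
        push_cast
        ring_nf
    _ = charFunDual (γ.tilted g) L := by
        rw [charFunDual_apply, integral_tilted, integral_exp_dual, hγ, ← integral_const_mul]
        congr with y
        rw [Complex.exp_add, Complex.real_smul]
        push_cast
        ring_nf

lemma lintegral_mul_exp_dual (g : StrongDual ℝ B) {F : B → ℝ≥0∞} (hF : Measurable F) :
    ∫⁻ z, F z * ENNReal.ofReal (Real.exp (g z)) ∂γ =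
      ENNReal.ofReal (Real.exp (Var[g; γ] / 2)) * ∫⁻ z, F (z + CM.incl γ (CM.ofDual γ g)) ∂γ := by
  rw [← lintegral_map (f := F) hF (by fun_prop), map_add_ofDual_eq_tilted hγ, lintegral_tilted,
    ← lintegral_const_mul _ (by fun_prop), integral_exp_dual, hγ, zero_add]
  refine lintegral_congr fun z => ?_
  rw [← mul_assoc, ← ENNReal.ofReal_mul (Real.exp_nonneg _),
    mul_div_cancel₀ _ (Real.exp_ne_zero _), mul_comm]

lemma ae_add_ofDual (g : StrongDual ℝ B) {Q : B → Prop} (hQ : ∀ᵐ y ∂γ, Q y) :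
    ∀ᵐ y ∂γ, Q (y + CM.incl γ (CM.ofDual γ g)) := by
  refine ae_of_ae_map (f := (· + CM.incl γ (CM.ofDual γ g))) (by fun_prop) ?_
  rw [map_add_ofDual_eq_tilted hγ]
  exact (tilted_absolutelyContinuous γ g).ae_le hQ

lemma measure_preimage_add_ofDual_le (g : StrongDual ℝ B) {U : Set B} (hU : MeasurableSet U) :
    γ ((· + CM.incl γ (CM.ofDual γ g)) ⁻¹' U) ≤
      ENNReal.ofReal (Real.exp (Var[g; γ] / 2)) * γ U ^ (1 / 2 : ℝ) := by
  have hshift : ENNReal.ofReal (Real.exp (Var[g; γ] / 2)) *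
      γ ((· + CM.incl γ (CM.ofDual γ g)) ⁻¹' U) =
        ∫⁻ y, U.indicator 1 y * ENNReal.ofReal (Real.exp (g y)) ∂γ := by
    rw [lintegral_mul_exp_dual hγ g (measurable_one.indicator hU),
      ← lintegral_indicator_one (measurable_add_const _ hU)]
    rfl
  have hsq : ∫⁻ y, (U.indicator 1 y : ℝ≥0∞) ^ (2 : ℝ) ∂γ = γ U := by
    rw [← lintegral_indicator_one hU]
    refine lintegral_congr fun y => ?_
    by_cases hy : y ∈ U <;> simp [hy]
  have hholder := ENNReal.lintegral_mul_le_Lp_mul_Lq γ Real.HolderConjugate.two_two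
    (measurable_one.indicator hU).aemeasurable
    (g := fun y => ENNReal.ofReal (Real.exp (g y))) (by fun_prop)
  have hexp : (2 ^ 2 * Var[g; γ] / 2) * (1 / 2) = Var[g; γ] / 2 + Var[g; γ] / 2 := by ring
  rw [hsq, lintegral_exp_dual_rpow, hγ, mul_zero, zero_add,
    ENNReal.ofReal_rpow_of_pos (Real.exp_pos _), ← Real.exp_mul, hexp, Real.exp_add,
    ENNReal.ofReal_mul (Real.exp_nonneg _), mul_left_comm] at hholder
  exact (ENNReal.mul_le_mul_iff_right (by simpa using Real.exp_pos _) ENNReal.ofReal_ne_top).mp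
    (hshift.trans_le (hholder.trans_eq (by rw [mul_comm (γ U ^ _)])))

lemma map_add_incl_absolutelyContinuous (h : CM γ) : γ.map (· + CM.incl γ h) ≪ γ := by
  have hbound (U : Set B) (hU : IsOpen U) (k : CM γ) : γ ((· + CM.incl γ k) ⁻¹' U) ≤
      ENNReal.ofReal (Real.exp (‖k‖ ^ 2 / 2)) * γ U ^ (1 / 2 : ℝ) := by
    have hlsc := (lowerSemicontinuous_measure_preimage_add_const γ hU).comp (CM.continuous_incl γ)
    have hcont : Continuous fun k : CM γ =>
        ENNReal.ofReal (Real.exp (‖k‖ ^ 2 / 2)) * γ U ^ (1 / 2 : ℝ) :=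
      (ENNReal.continuous_mul_const (by finiteness)).comp
        (ENNReal.continuous_ofReal.comp (by fun_prop))
    induction k using (CM.denseRange_ofDual γ).induction_on with
    | hp => exact hlsc.isClosed_epigraph.preimage (continuous_id.prodMk hcont)
    | ih g =>
      simpa only [CM.norm_sq_ofDual hγ] using
        measure_preimage_add_ofDual_le hγ g hU.measurableSet
  have hθ : Continuous fun r : ℝ≥0∞ =>
      ENNReal.ofReal (Real.exp (‖h‖ ^ 2 / 2)) * r ^ (1 / 2 : ℝ) :=
    (ENNReal.continuous_const_mul ENNReal.ofReal_ne_top).comp ENNReal.continuous_rpow_const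
  refine absolutelyContinuous_of_forall_isOpen_le (hθ.tendsto' 0 0 (by simp)) fun U hU => ?_
  rw [Measure.map_apply (by fun_prop) hU.measurableSet]
  exact hbound U hU h

lemma conv_absolutelyContinuous {μ : Measure B} [SFinite μ]
    (hμ : ∀ᵐ x ∂μ, x ∈ cameronMartin γ) : μ.conv γ ≪ γ :=
  conv_absolutelyContinuous_of_ae_map_add <|
    hμ.mono fun x hx => map_add_incl_absolutelyContinuous hγ ⟨x, hx⟩

end CameronMartin

section Derivative

lemma hasDerivAt_cgf_zero {α : Type*} [MeasurableSpace α] {m : Measure α} {U : α → ℝ}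
    (hpos : Integrable (fun x => Real.exp (U x)) m)
    (hneg : Integrable (fun x => Real.exp (-U x)) m) :
    HasDerivAt (cgf U m) (m[U] / m.real Set.univ) 0 := by
  have hIcc : Set.Icc (-1) 1 ⊆ integrableExpSet U m :=
    convex_integrableExpSet.ordConnected.out (by simpa [integrableExpSet] using hneg)
      (by simpa [integrableExpSet] using hpos)
  have h0 : (0 : ℝ) ∈ interior (integrableExpSet U m) :=
    mem_interior_iff_mem_nhds.mpr
      (Filter.mem_of_superset (Icc_mem_nhds (by norm_num) (by norm_num)) hIcc)
  rw [← deriv_cgf_zero h0]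
  exact (analyticAt_cgf h0).differentiableAt.hasDerivAt

lemma eq_of_hasDerivAt_of_forall_rat {F G : ℝ → ℝ} {a b : ℝ} (hF : HasDerivAt F a 0)
    (hG : HasDerivAt G b 0) (h : ∀ t : ℚ, F t = G t) : a = b := by
  have hdense : UniqueDiffWithinAt ℝ (Set.range ((↑) : ℚ → ℝ)) 0 := by
    rw [← uniqueDiffWithinAt_closure, Rat.denseRange_cast.closure_range]
    exact uniqueDiffWithinAt_univ
  refine hdense.eq_deriv _ hF.hasDerivWithinAt (hG.hasDerivWithinAt.congr ?_ ?_)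
  · rintro _ ⟨t, rfl⟩
    exact h t
  · exact_mod_cast h 0

variable {B : Type*} [NormedAddCommGroup B] [NormedSpace ℝ B] [CompleteSpace B]
  [SecondCountableTopology B] [MeasurableSpace B] [BorelSpace B] {γ : Measure B} [IsGaussian γ]

lemma DifferentiableAlongAt.hasDerivAt {f : B → ℝ} {y : B} (hf : DifferentiableAlongAt γ f y)
    (h : CM γ) : HasDerivAt (fun t : ℝ => f (y + CM.incl γ (t • h))) (derivAlong γ f y h) 0 := by
  have hline : HasDerivAt (fun t : ℝ => t • h) h 0 := by
    simpa using (hasDerivAt_id (0 : ℝ)).smul_const h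
  exact HasFDerivAt.comp_hasDerivAt_of_eq 0 (DifferentiableAt.hasFDerivAt hf) hline
    (zero_smul ℝ h).symm

end Derivative

section Posterior

lemma ae_integrable_id_condDistrib_add {E : Type*} [NormedAddCommGroup E] [CompleteSpace E]
    [SecondCountableTopology E] [MeasurableSpace E] [BorelSpace E] {Ω : Type*} [MeasurableSpace Ω]
    {P : Measure Ω} [IsFiniteMeasure P] {X Z : Ω → E} (hX : Measurable X) (hZ : Integrable Z P) :
    ∀ᵐ y ∂P.map (X + Z), Integrable id (condDistrib X (X + Z) P y) := by
  have hY : AEMeasurable (X + Z) P := hX.aemeasurable.add hZ.aemeasurable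
  have hdiff : Integrable (fun w : E × E => w.1 - w.2) (P.map fun ω => ((X + Z) ω, X ω)) := by
    rw [integrable_map_measure (by fun_prop) (hY.prodMk hX.aemeasurable)]
    simpa [Function.comp_def] using hZ
  filter_upwards [Integrable.condDistrib_ae_map hX.aemeasurable hdiff] with y hy
  simpa [Function.id_def, Pi.sub_def] using (integrable_const y).sub hy

variable {B : Type*} [NormedAddCommGroup B] [NormedSpace ℝ B] [CompleteSpace B]
  [SecondCountableTopology B] [MeasurableSpace B] [BorelSpace B] {γ : Measure B} [IsGaussian γ]
  {Ω : Type*} [MeasurableSpace Ω] {P : Measure Ω} [IsProbabilityMeasure P] {X Z : Ω → B}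
  (hγ : ∀ L : StrongDual ℝ B, ∫ z, L z ∂γ = 0)
  (hX : Measurable X) (hZ : Measurable Z) (hZγ : P.map Z = γ) (hXZ : IndepFun X Z P)

include hγ hX hZ hZγ hXZ

lemma lintegral_add_mul_exp_dual (g : StrongDual ℝ B) {F : B → ℝ≥0∞} (hF : Measurable F) :
    ∫⁻ ω, F (X ω + Z ω) * ENNReal.ofReal (Real.exp (g (Z ω))) ∂P =
      ENNReal.ofReal (Real.exp (Var[g; γ] / 2)) *
        ∫⁻ ω, F (X ω + Z ω + CM.incl γ (CM.ofDual γ g)) ∂P := by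
  have hjoint : P.map (fun ω => (X ω, Z ω)) = (P.map X).prod γ := by
    rw [(indepFun_iff_map_prod_eq_prod_map_map hX.aemeasurable hZ.aemeasurable).mp hXZ, hZγ]
  have hdisintegrate {G : B × B → ℝ≥0∞} (hG : Measurable G) :
      ∫⁻ ω, G (X ω, Z ω) ∂P = ∫⁻ x, ∫⁻ z, G (x, z) ∂γ ∂P.map X := by
    rw [← lintegral_prod _ hG.aemeasurable, ← hjoint, lintegral_map hG (hX.prodMk hZ)]
  rw [hdisintegrate (G := fun w => F (w.1 + w.2) * ENNReal.ofReal (Real.exp (g w.2)))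
      (by fun_prop),
    hdisintegrate (G := fun w => F (w.1 + w.2 + CM.incl γ (CM.ofDual γ g))) (by fun_prop),
    ← lintegral_const_mul _ (by fun_prop)]
  refine lintegral_congr fun x => ?_
  rw [lintegral_mul_exp_dual hγ g (F := fun z => F (x + z)) (by fun_prop)]
  simp only [add_assoc]

variable (hν : P.map (X + Z) ≪ γ)

include hν

lemma lintegral_mul_rnDeriv_add_ofDual (g : StrongDual ℝ B) {F : B → ℝ≥0∞} (hF : Measurable F) :
    ∫⁻ y, F y * (P.map (X + Z)).rnDeriv γ (y + CM.incl γ (CM.ofDual γ g)) ∂γ =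
      ∫⁻ ω, F (X ω + Z ω) * ENNReal.ofReal (Real.exp (g (X ω))) ∂P := by
  set q := (P.map (X + Z)).rnDeriv γ
  have hq : Measurable q := Measure.measurable_rnDeriv _ _
  let G : B → ℝ≥0∞ := fun y => F y * ENNReal.ofReal (Real.exp (g y))
  have hG : Measurable G := by fun_prop
  have hcancel (y z : B) : F y * ENNReal.ofReal (Real.exp (g z)) =
      G y * ENNReal.ofReal (Real.exp ((-g) (y - z))) := by
    rw [mul_assoc, ← ENNReal.ofReal_mul (Real.exp_nonneg _), ← Real.exp_add]
    simp
  calc ∫⁻ y, F y * q (y + CM.incl γ (CM.ofDual γ g)) ∂γ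
      = ∫⁻ y, G y * q (y + CM.incl γ (CM.ofDual γ g)) *
          ENNReal.ofReal (Real.exp ((-g) y)) ∂γ := by
        refine lintegral_congr fun y => ?_
        have h := hcancel y 0
        rw [map_zero, Real.exp_zero, ENNReal.ofReal_one, mul_one, sub_zero] at h
        rw [h, mul_right_comm]
    _ = ENNReal.ofReal (Real.exp (Var[-g; γ] / 2)) *
          ∫⁻ y, G (y + CM.incl γ (CM.ofDual γ (-g))) * q y ∂γ := by
        rw [lintegral_mul_exp_dual hγ (-g)
          (F := fun y => G y * q (y + CM.incl γ (CM.ofDual γ g))) (by fun_prop)]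
        simp only [map_neg, neg_add_cancel_right]
    _ = ENNReal.ofReal (Real.exp (Var[-g; γ] / 2)) *
          ∫⁻ ω, G (X ω + Z ω + CM.incl γ (CM.ofDual γ (-g))) ∂P := by
        simp only [mul_comm (G _)]
        rw [lintegral_rnDeriv_mul hν (by fun_prop), lintegral_map (by fun_prop) (hX.add hZ)]
        rfl
    _ = ∫⁻ ω, G (X ω + Z ω) * ENNReal.ofReal (Real.exp ((-g) (Z ω))) ∂P :=
        (lintegral_add_mul_exp_dual hγ hX hZ hZγ hXZ (-g) hG).symm
    _ = ∫⁻ ω, F (X ω + Z ω) * ENNReal.ofReal (Real.exp (g (X ω))) ∂P := by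
        simp only [hcancel, add_sub_cancel_left]

lemma ae_rnDeriv_add_ofDual (g : StrongDual ℝ B) :
    ∀ᵐ y ∂γ, (P.map (X + Z)).rnDeriv γ (y + CM.incl γ (CM.ofDual γ g)) =
      (P.map (X + Z)).rnDeriv γ y *
        ∫⁻ x, ENNReal.ofReal (Real.exp (g x)) ∂condDistrib X (X + Z) P y := by
  have hq : Measurable ((P.map (X + Z)).rnDeriv γ) := Measure.measurable_rnDeriv _ _
  have hY : Measurable (X + Z) := hX.add hZ
  have : IsProbabilityMeasure (P.map (X + Z)) := Measure.isProbabilityMeasure_map hY.aemeasurable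
  have hT : Measurable fun y =>
      ∫⁻ x, ENNReal.ofReal (Real.exp (g x)) ∂condDistrib X (X + Z) P y :=
    Measurable.lintegral_kernel (by fun_prop)
  refine ae_eq_of_forall_setLIntegral_eq_of_sigmaFinite (by fun_prop) (hq.mul hT)
    fun s hs _ => ?_
  let F : B → ℝ≥0∞ := s.indicator 1
  have hF : Measurable F := measurable_one.indicator hs
  have hexp : Measurable fun x : B => ENNReal.ofReal (Real.exp (g x)) := by fun_prop
  have hFexp : Measurable fun w : B × B => F w.1 * ENNReal.ofReal (Real.exp (g w.2)) := by
    fun_prop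
  have hset (H : B → ℝ≥0∞) : ∫⁻ y in s, H y ∂γ = ∫⁻ y, F y * H y ∂γ := by
    rw [← lintegral_indicator hs]
    refine lintegral_congr fun y => ?_
    by_cases hy : y ∈ s <;> simp [F, hy]
  calc ∫⁻ y in s, (P.map (X + Z)).rnDeriv γ (y + CM.incl γ (CM.ofDual γ g)) ∂γ
      = ∫⁻ ω, F (X ω + Z ω) * ENNReal.ofReal (Real.exp (g (X ω))) ∂P := by
        rw [hset, lintegral_mul_rnDeriv_add_ofDual hγ hX hZ hZγ hXZ hν g hF]
    _ = ∫⁻ w, F w.1 * ENNReal.ofReal (Real.exp (g w.2)) ∂P.map fun ω => ((X + Z) ω, X ω) :=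
        (lintegral_map hFexp (hY.prodMk hX)).symm
    _ = ∫⁻ y, F y * ∫⁻ x, ENNReal.ofReal (Real.exp (g x)) ∂condDistrib X (X + Z) P y
          ∂P.map (X + Z) := by
        rw [← compProd_map_condDistrib hX.aemeasurable, Measure.lintegral_compProd hFexp]
        exact lintegral_congr fun y => lintegral_const_mul (F y) hexp
    _ = _ := by
        rw [hset, ← lintegral_rnDeriv_mul hν (by fun_prop)]
        simp only [mul_left_comm]

lemma ae_log_rnDeriv_add_ofDual (g : StrongDual ℝ B) :
    ∀ᵐ y ∂P.map (X + Z), Integrable (fun x => Real.exp (g x)) (condDistrib X (X + Z) P y) ∧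
      Real.log ((P.map (X + Z)).rnDeriv γ (y + CM.incl γ (CM.ofDual γ g))).toReal =
        Real.log ((P.map (X + Z)).rnDeriv γ y).toReal + cgf g (condDistrib X (X + Z) P y) 1 := by
  have hfin := Measure.rnDeriv_lt_top (P.map (X + Z)) γ
  filter_upwards [Measure.rnDeriv_pos hν, hν.ae_le hfin, hν.ae_le (ae_add_ofDual hγ g hfin),
    hν.ae_le (ae_rnDeriv_add_ofDual hγ hX hZ hZγ hXZ hν g)] with y hpos hlt hlt_add hadd
  have hint : Integrable (fun x => Real.exp (g x)) (condDistrib X (X + Z) P y) := by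
    refine ⟨by fun_prop, ?_⟩
    rw [hasFiniteIntegral_iff_ofReal (ae_of_all _ fun _ => Real.exp_nonneg _)]
    exact ENNReal.lt_top_of_mul_ne_top_right (hadd ▸ hlt_add.ne) hpos.ne'
  refine ⟨hint, ?_⟩
  rw [hadd, ← ofReal_integral_eq_lintegral_ofReal hint (ae_of_all _ fun _ => Real.exp_nonneg _),
    ENNReal.toReal_mul, ENNReal.toReal_ofReal (integral_nonneg fun _ => Real.exp_nonneg _),
    Real.log_mul (ENNReal.toReal_pos hpos.ne' hlt.ne).ne' (integral_exp_pos hint).ne']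
  simp only [cgf, mgf, one_mul]

lemma ae_derivAlong_ofDual {φ : B → ℝ}
    (hφ : φ =ᵐ[γ] fun y => Real.log ((P.map (X + Z)).rnDeriv γ y).toReal)
    (hφ' : ∀ᵐ y ∂γ, DifferentiableAlongAt γ φ y) (g : StrongDual ℝ B) :
    ∀ᵐ y ∂P.map (X + Z),
      derivAlong γ φ y (CM.ofDual γ g) = ∫ x, g x ∂condDistrib X (X + Z) P y := by
  have hlog := ae_all_iff.mpr fun t : ℚ =>
    ae_log_rnDeriv_add_ofDual hγ hX hZ hZγ hXZ hν ((t : ℝ) • g)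
  have hφ_add := ae_all_iff.mpr fun t : ℚ => ae_add_ofDual hγ ((t : ℝ) • g) hφ
  filter_upwards [hlog, hν.ae_le hφ_add, hν.ae_le hφ'] with y hy hφy hdiff
  set κ := condDistrib X (X + Z) P y
  have hcgf : HasDerivAt (fun t => Real.log ((P.map (X + Z)).rnDeriv γ y).toReal + cgf g κ t)
      (κ[g]) 0 := by
    have h := hasDerivAt_cgf_zero (m := κ) (U := g) (by simpa using (hy 1).1)
      (by simpa using (hy (-1)).1)
    rw [probReal_univ, div_one] at h
    exact h.const_add _
  refine eq_of_hasDerivAt_of_forall_rat (hdiff.hasDerivAt _) hcgf fun t => ?_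
  rw [← map_smul, hφy, (hy t).2]
  simp [cgf, mgf]

lemma ae_integral_condDistrib_add_eq_riesz {φ : B → ℝ}
    (hφ : φ =ᵐ[γ] fun y => Real.log ((P.map (X + Z)).rnDeriv γ y).toReal)
    (hφ' : ∀ᵐ y ∂γ, DifferentiableAlongAt γ φ y) :
    ∀ᵐ y ∂P.map (X + Z), Integrable id (condDistrib X (X + Z) P y) ∧
      ∫ x, x ∂condDistrib X (X + Z) P y = CM.incl γ (riesz γ (derivAlong γ φ y)) := by
  have hZint : Integrable Z P := by
    refine (integrable_map_measure (g := id) (by fun_prop) hZ.aemeasurable).mp ?_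
    rw [hZγ]
    exact IsGaussian.integrable_id
  have hint := ae_integrable_id_condDistrib_add hX hZint
  have hmean : (fun y => ∫ x, x ∂condDistrib X (X + Z) P y -
      CM.incl γ (riesz γ (derivAlong γ φ y))) =ᵐ[P.map (X + Z)] 0 := by
    refine ae_eq_zero_of_forall_dual ℝ fun g => ?_
    filter_upwards [hint, ae_derivAlong_ofDual hγ hX hZ hZγ hXZ hν hφ hφ' g] with y hy hder
    rw [map_sub, Pi.zero_apply, sub_eq_zero, ← CM.inner_ofDual, riesz,
      InnerProductSpace.toDual_symm_apply, hder]
    exact (g.integral_comp_comm hy).symm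
  filter_upwards [hint, hmean] with y hy hmean_y
  exact ⟨hy, sub_eq_zero.mp hmean_y⟩

end Posterior

end Tweedie

theorem theorem1_general
    {B : Type*} [NormedAddCommGroup B] [NormedSpace ℝ B] [CompleteSpace B]
    [SecondCountableTopology B] [MeasurableSpace B] [BorelSpace B]
    {Ω : Type*} [MeasurableSpace Ω] (P : Measure Ω) [IsProbabilityMeasure P]
    (μ γ : Measure B) [IsGaussian γ] (hγ : ∀ L : StrongDual ℝ B, ∫ z, L z ∂γ = 0)
    (X Z : Ω → B) (hX : Measurable X) (hZ : Measurable Z)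
    (hXμ : P.map X = μ) (hZγ : P.map Z = γ) (hXZ : IndepFun X Z P)
    (hμ : ∀ᵐ x ∂μ, x ∈ Tweedie.cameronMartin γ)
    (φ : B → ℝ)
    (hφ : φ =ᵐ[γ] fun y => Real.log ((μ.conv γ).rnDeriv γ y).toReal)
    (hφ' : ∀ᵐ y ∂γ, Tweedie.DifferentiableAlongAt γ φ y) :
    (∀ᵐ y ∂(μ.conv γ), Integrable (fun x : B => x) (condDistrib X (X + Z) P y) ∧
      ∫ x, x ∂(condDistrib X (X + Z) P y) =
        Tweedie.CM.incl γ (Tweedie.riesz γ (Tweedie.derivAlong γ φ y))) ∧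
    (Integrable X P →
      P[X | MeasurableSpace.comap (X + Z) inferInstance] =ᵐ[P]
        fun ω => Tweedie.CM.incl γ
          (Tweedie.riesz γ (Tweedie.derivAlong γ φ (X ω + Z ω)))) := by
  have hY : Measurable (X + Z) := hX.add hZ
  have : SFinite μ := hXμ ▸ inferInstance
  have hlaw : P.map (X + Z) = μ.conv γ := by
    rw [hXZ.map_add_eq_map_conv_map hX hZ, hXμ, hZγ]
  have hν : μ.conv γ ≪ γ := Tweedie.conv_absolutelyContinuous hγ hμ
  rw [← hlaw] at hφ hν ⊢
  have hmean := Tweedie.ae_integral_condDistrib_add_eq_riesz hγ hX hZ hZγ hXZ hν hφ hφ'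
  refine ⟨hmean, fun hXint => ?_⟩
  filter_upwards [condExp_ae_eq_integral_condDistrib' hY hXint,
    ae_of_ae_map hY.aemeasurable hmean] with ω hcond hω
  exact hcond.trans hω.2

theorem theorem1
    {B : Type*} [NormedAddCommGroup B] [NormedSpace ℝ B] [CompleteSpace B]
    [SecondCountableTopology B] [MeasurableSpace B] [BorelSpace B]
    {Ω : Type*} [MeasurableSpace Ω] (P : Measure Ω) [IsProbabilityMeasure P]
    (μ γ : Measure B)
    -- `γ` is a centered Gaussian measure
    [IsGaussian γ] (hγ : ∀ L : StrongDual ℝ B, ∫ z, L z ∂γ = 0)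
    -- `X ∼ μ` and `Z ∼ γ` are independent
    (X Z : Ω → B) (hX : Measurable X) (hZ : Measurable Z)
    (hXμ : P.map X = μ) (hZγ : P.map Z = γ) (hXZ : IndepFun X Z P)
    -- `μ(H(γ)) = 1` (the set `H(γ)` is Borel)
    (hμ : ∀ᵐ x ∂μ, x ∈ Tweedie.cameronMartin γ)
    -- `φ` is a version of `log dν/dγ`, `ν = μ ∗ γ`, Fréchet differentiable along `H(γ)`
    (φ : B → ℝ)
    (hφ : φ =ᵐ[γ] fun y => Real.log ((μ.conv γ).rnDeriv γ y).toReal)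
    (hφ' : ∀ᵐ y ∂γ, Tweedie.DifferentiableAlongAt γ φ y)
    -- `p x` is a version of `dγ^x/dγ`, measurable in both variables
    (p : B → B → ℝ) (hp : Measurable (Function.uncurry p))
    (hpγ : ∀ᵐ x ∂μ, p x =ᵐ[γ] fun y => ((γ.map (fun z => z + x)).rnDeriv γ y).toReal)
    -- its derivatives along `H(γ)` at `y` are bounded by a `μ`-integrable function of `x`
    (hp' : ∀ᵐ y ∂γ, ∃ ψ : B → ℝ, Integrable ψ μ ∧
      ∀ᵐ x ∂μ, Tweedie.DifferentiableAlongAt γ (p x) y ∧ ‖Tweedie.derivAlong γ (p x) y‖ ≤ ψ x) :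
    -- `E[X | Y = y]` is the mean of the regular conditional law of `X` given `Y = y`
    (∀ᵐ y ∂(μ.conv γ), Integrable (fun x : B => x) (condDistrib X (X + Z) P y) ∧
      ∫ x, x ∂(condDistrib X (X + Z) P y) =
        Tweedie.CM.incl γ (Tweedie.riesz γ (Tweedie.derivAlong γ φ y))) ∧
    -- in particular, the formula holds for the conditional expectation of an integrable `X`
    (Integrable X P →
      P[X | MeasurableSpace.comap (X + Z) inferInstance] =ᵐ[P]
        fun ω => Tweedie.CM.incl γ
          (Tweedie.riesz γ (Tweedie.derivAlong γ φ (X ω + Z ω)))) :=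
  theorem1_general P μ γ hγ X Z hX hZ hXμ hZγ hXZ hμ φ hφ hφ'
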